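/- A \emph{lattice path} is a finite word in the steps $E=(1,0)$ and $N=(0,1)$, starting at $(0,0)$. A \emph{path presentation} $[P,Q]$ consists of two lattice paths $P=p_1\cdots p_{m+r}$ and $Q=q_1\cdots q_{m+r}$ from $(0,0)$ to the same point $(m,r)$, $m,r\ge 0$, such that $P$ never goes above $Q$: for every $i$, the initial segment $P_i$ of $P$ of length $i$ has at most as many North steps as the initial segment $Q_i$ of $Q$ of length $i$. If $u_1<\dots<u_r$ and $l_1<\dots<l_r$ are the positions of the North steps of $P$ and of $Q$, then $M[P,Q]$ is the transversal matroid on $\{1,\dots,m+r\}$ presented by the intervals $N_j=[l_j,u_j]$, $1\le j\le r$ (its independent sets are the partial transversals of $(N_1,\dots,N_r)$). A \emph{lattice path matroid} is a matroid isomorphic to some $M[P,Q]$. The presentation $[P,Q]$ has a \emph{$k\times k$ square at $i$}, where $1\le i\le m+r$, if $P_i$ has exactly $k$ more East steps than $Q_i$ and $Q_i$ has exactly $k$ more North steps than $P_i$. Its \emph{square-width} is the largest $k$ such that it has a $k\times k$ square (and $0$ if $m+r=0$). For an integer $k\ge 0$ let $\mathcal L_k$ be the class of all matroids that are isomorphic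 to $M[P,Q]$ for some path presentation $[P,Q]$ of square-width at most $k$. Quasi-order $\mathcal L_k$ by $M\le M'$ if $M$ is isomorphic to a minor of $M'$. \textbf{Theorem.} For every $k\ge 0$, $\mathcal L_k$ is well-quasi-ordered: $\le$ is reflexive and transitive on $\mathcal L_k$, and for every infinite sequence $M_0,M_1,M_2,\dots$ in $\mathcal L_k$ there are $i<j$ such that $M_i\le M_j$. -/

import Mathlib

universe u v

/-! ### Isomorphism of matroids and the minor quasi-order -/

/-- Two matroids (possibly on different types) are isomorphic: there is a bijection between the
ground sets under which independent sets correspond to independent sets. -/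
def MatroidIso {α : Type u} {β : Type v} (M : Matroid α) (N : Matroid β) : Prop :=
  ∃ e : M.E ≃ N.E, ∀ I : Set M.E,
    M.Indep (Subtype.val '' I) ↔ N.Indep (Subtype.val '' (e '' I))

/-- `M` is, up to isomorphism, a minor of `N`. -/
def IsMinorUpToIso {α : Type u} {β : Type v} (M : Matroid α) (N : Matroid β) : Prop :=
  ∃ N' : Matroid β, N'.IsMinor N ∧ MatroidIso M N'

/-! ### Transversal matroids -/

/-- `X` is a partial transversal of the family `A`: its elements can be assigned pairwise distinct
indices `f x` with `x ∈ A (f x)`. -/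
def IsPartialTransversal {α : Type u} {ι : Type v} (A : ι → Set α) (X : Set α) : Prop :=
  ∃ f : X → ι, Function.Injective f ∧ ∀ x : X, (x : α) ∈ A (f x)

theorem IsPartialTransversal.empty {α : Type u} {ι : Type v} (A : ι → Set α) :
    IsPartialTransversal A ∅ :=
  ⟨fun x => x.2.elim, fun x => x.2.elim, fun x => x.2.elim⟩

theorem IsPartialTransversal.subset {α : Type u} {ι : Type v} {A : ι → Set α} {X Y : Set α}
    (hY : IsPartialTransversal A Y) (h : X ⊆ Y) : IsPartialTransversal A X := by
  obtain ⟨f, hf, hA⟩ := hY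
  exact ⟨f ∘ Set.inclusion h, hf.comp (Set.inclusion_injective h), fun x => hA (Set.inclusion h x)⟩

/-- The augmentation property, with the matching of `I` and the number of elements of `J` on which
it does not yet agree with the matching of `J` kept explicit. -/
theorem IsPartialTransversal.augment_aux {α : Type u} {ι : Type v} [Finite α] {A : ι → Set α}
    {I J : Set α} (hcard : I.ncard < J.ncard) (g : J → ι) (hg : Function.Injective g)
    (hgA : ∀ x : J, (x : α) ∈ A (g x)) (n : ℕ) :
    ∀ f : I → ι, Function.Injective f → (∀ x : I, (x : α) ∈ A (f x)) →
      {y : J | ∀ h : (y : α) ∈ I, f ⟨y, h⟩ ≠ g y}.ncard ≤ n →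
      ∃ e ∈ J, e ∉ I ∧ IsPartialTransversal A (insert e I) := by
  classical
  induction n with
  | zero =>
    intro f hf hfA hn
    have h0 := (Set.ncard_eq_zero (Set.toFinite _)).1 (Nat.le_zero.1 hn)
    refine absurd (Set.ncard_le_ncard (fun y hy => ?_) (Set.toFinite I)) (not_le.2 hcard)
    by_contra hyI
    have : (⟨y, hy⟩ : J) ∈ ({y : J | ∀ h : (y : α) ∈ I, f ⟨y, h⟩ ≠ g y} : Set J) :=
      fun h => absurd h hyI
    rw [h0] at this
    exact this
  | succ n ih =>
    intro f hf hfA hn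
    obtain ⟨y, hy⟩ : ∃ y : J, g y ∉ Set.range f := by
      by_contra! hcon
      choose t ht using hcon
      have ht' : Function.Injective t := fun a b hab => hg (by rw [← ht a, ← ht b, hab])
      have := Nat.card_le_card_of_injective t ht'
      rw [Nat.card_coe_set_eq, Nat.card_coe_set_eq] at this
      omega
    by_cases hyI : (y : α) ∈ I
    · have hne : f ⟨y, hyI⟩ ≠ g y := fun h => hy ⟨_, h⟩
      refine ih (Function.update f ⟨y, hyI⟩ (g y)) ?_ ?_ ?_
      · intro a b hab
        by_cases ha : a = ⟨y, hyI⟩ <;> by_cases hb : b = ⟨y, hyI⟩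
        · rw [ha, hb]
        · subst ha
          rw [Function.update_self, Function.update_of_ne hb] at hab
          exact absurd ⟨b, hab.symm⟩ hy
        · subst hb
          rw [Function.update_self, Function.update_of_ne ha] at hab
          exact absurd ⟨a, hab⟩ hy
        · rw [Function.update_of_ne ha, Function.update_of_ne hb] at hab
          exact hf hab
      · intro x
        by_cases hx : x = ⟨y, hyI⟩
        · subst hx
          rw [Function.update_self]
          exact hgA y
        · rw [Function.update_of_ne hx]
          exact hfA x
      · refine Nat.le_of_lt_succ (lt_of_lt_of_le (Set.ncard_lt_ncard ?_ (Set.toFinite _)) hn)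
        refine (Set.ssubset_iff_of_subset ?_).2 ⟨y, fun h => hne, ?_⟩
        · intro z hz h
          have hz' := hz h
          by_cases hzy : (⟨z, h⟩ : I) = ⟨y, hyI⟩
          · have hzy' : z = y := Subtype.ext (congrArg (fun t : I => (t : α)) hzy)
            subst hzy'
            exact hne
          · rwa [Function.update_of_ne hzy] at hz'
        · intro h
          exact h hyI (Function.update_self _ _ _)
    · refine ⟨y, y.2, hyI, fun x => if h : (x : α) ∈ I then f ⟨x, h⟩ else g y, ?_, ?_⟩
      · rintro ⟨a, ha⟩ ⟨b, hb⟩ hab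
        by_cases haI : a ∈ I <;> by_cases hbI : b ∈ I
        · simp only [haI, hbI, dif_pos] at hab
          exact Subtype.ext (congrArg (fun t : I => (t : α)) (hf hab))
        · simp only [haI, hbI, dif_pos, dif_neg, not_false_eq_true] at hab
          exact absurd ⟨_, hab⟩ hy
        · simp only [haI, hbI, dif_pos, dif_neg, not_false_eq_true] at hab
          exact absurd ⟨_, hab.symm⟩ hy
        · exact Subtype.ext ((ha.resolve_right haI).trans (hb.resolve_right hbI).symm)
      · rintro ⟨a, ha⟩
        by_cases haI : a ∈ I
        · simp only [haI, dif_pos]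
          exact hfA ⟨a, haI⟩
        · simp only [haI, dif_neg, not_false_eq_true]
          rw [ha.resolve_right haI]
          exact hgA y

/-- The transversal matroid on the finite set `α` presented by the family `A`: its independent sets
are the partial transversals of `A`. -/
def transversalMatroid {α : Type u} {ι : Type v} [Finite α] (A : ι → Set α) : Matroid α :=
  (IndepMatroid.ofFinite (E := Set.univ) Set.finite_univ (IsPartialTransversal A)
    (IsPartialTransversal.empty A)
    (fun _ _ hJ hIJ => hJ.subset hIJ)
    (fun _ _ hI hJ hIJ =>
      let ⟨f, hf, hfA⟩ := hI
      let ⟨g, hg, hgA⟩ := hJ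
      IsPartialTransversal.augment_aux hIJ g hg hgA _ f hf hfA le_rfl)
    (fun _ _ => Set.subset_univ _)).matroid

theorem transversalMatroid_ground {α : Type u} {ι : Type v} [Finite α] (A : ι → Set α) :
    (transversalMatroid A).E = Set.univ := rfl

theorem transversalMatroid_indep {α : Type u} {ι : Type v} [Finite α] (A : ι → Set α)
    (I : Set α) : (transversalMatroid A).Indep I ↔ IsPartialTransversal A I := Iff.rfl

/-! ### Lattice paths and lattice path matroids -/

/-- The two steps of a lattice path: East `(1, 0)` and North `(0, 1)`. -/
inductive Step : Type
  | east : Step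
  | north : Step
  deriving DecidableEq

/-- A lattice path starting at `(0, 0)`, written as a word in the steps East and North. -/
abbrev LatticePath : Type := List Step

/-- The number of East steps among the first `i` steps. -/
def LatticePath.eastCount (P : LatticePath) (i : ℕ) : ℕ := (P.take i).count Step.east

/-- The number of North steps among the first `i` steps. -/
def LatticePath.northCount (P : LatticePath) (i : ℕ) : ℕ := (P.take i).count Step.north

/-- The position of the `j`-th North step (positions and `j` both counted from `0`). -/
noncomputable def LatticePath.northPos (P : LatticePath) (j : ℕ) : ℕ :=
  Nat.nth (fun x => P[x]? = some Step.north) j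

/-- A path presentation `[P, Q]`: two lattice paths `P = lower` and `Q = upper` from `(0, 0)` to
`(m, r)` such that `P` never goes above `Q`. -/
structure PathPresentation (m r : ℕ) where
  lower : LatticePath
  upper : LatticePath
  lower_east : lower.count Step.east = m
  lower_north : lower.count Step.north = r
  upper_east : upper.count Step.east = m
  upper_north : upper.count Step.north = r
  lower_le_upper : ∀ i : ℕ, lower.northCount i ≤ upper.northCount i

namespace PathPresentation

/-- The interval `N_j = [l_j, u_j]` where `l_j` and `u_j` are the positions of the `j`-th North step
of the upper and of the lower path. -/
def interval {m r : ℕ} (S : PathPresentation m r) (j : Fin r) : Set (Fin (m + r)) :=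
  {x | S.upper.northPos j ≤ x ∧ (x : ℕ) ≤ S.lower.northPos j}

/-- The matroid `M[P, Q]` on an `(m + r)`-element ground set: the transversal matroid presented by
the intervals `N_j`. -/
def matroid {m r : ℕ} (S : PathPresentation m r) : Matroid (Fin (m + r)) :=
  transversalMatroid S.interval

/-- `[P, Q]` has a `k × k` square at `i`. -/
def HasSquareAt {m r : ℕ} (S : PathPresentation m r) (k i : ℕ) : Prop :=
  1 ≤ i ∧ i ≤ m + r ∧
    S.lower.eastCount i = S.upper.eastCount i + k ∧
    S.upper.northCount i = S.lower.northCount i + k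

/-- The square-width of `[P, Q]`: the largest `k` such that `[P, Q]` has a `k × k` square. -/
noncomputable def squareWidth {m r : ℕ} (S : PathPresentation m r) : ℕ :=
  sSup {k | ∃ i, S.HasSquareAt k i}

theorem bddAbove_squares {m r : ℕ} (S : PathPresentation m r) :
    BddAbove {k | ∃ i, S.HasSquareAt k i} := by
  refine ⟨r, ?_⟩
  rintro k ⟨i, -, -, -, h⟩
  have h1 : S.upper.northCount i ≤ S.upper.count Step.north :=
    (List.take_sublist i S.upper).count_le _
  have h2 := S.upper_north
  omega

theorem squareWidth_le_iff {m r : ℕ} (S : PathPresentation m r) (k : ℕ) :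
    S.squareWidth ≤ k ↔ ∀ j i, S.HasSquareAt j i → j ≤ k := by
  constructor
  · intro h j i hji
    exact (le_csSup S.bddAbove_squares ⟨i, hji⟩).trans h
  · intro h
    rcases Set.eq_empty_or_nonempty {k | ∃ i, S.HasSquareAt k i} with h0 | h0
    · simp [squareWidth, h0]
    · exact csSup_le h0 fun j ⟨i, hji⟩ => h j i hji

end PathPresentation

/-- The class of lattice path matroids with square-width at most `k`: all matroids, on arbitrary
types, that are isomorphic to `M[P, Q]` for some path presentation `[P, Q]` of square-width at
most `k`. -/
def latticePathClass (k : ℕ) : Set (Σ α : Type u, Matroid α) :=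
  {M | ∃ (m r : ℕ) (S : PathPresentation m r), S.squareWidth ≤ k ∧ MatroidIso M.2 S.matroid}

/-!
A presentation `[P, Q]` is a word in the letters `(p, q)` of `Step × Step`; its height after `t`
letters is the number of North steps by which `Q` leads over `P`. The square-width bounds the
height, and the theorem reduces to a statement about words of bounded height, because three local
reductions of words give single-element minors (`Presents.exists_minor_of_reduction`):

* dropping a letter (East, East) deletes its element;
* dropping a letter (North, North) contracts its element;
* replacing the adjacent letters (East, North), (North, East) by (North, North) deletes the element
  of the first.

To verify this, independence is read off the word by one scan from left to right. By Hall's theorem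
for intervals with increasing ends, a set `I` is independent exactly if no window `[s, t)` contains
more elements of `I` than there are intervals meeting it (`isPartialTransversal_iff_windows`). This
is also the condition under which the greedy matching, which keeps only the number `d` of open
intervals and the number `a` of those still unmatched, never gets stuck (`Feasible`,
`Feasible.iff_windows`). Each reduction leaves the pair `(d, a)` at its end unchanged if the lost
element is left out of `I` (deletion) or put into `I` (contraction), so that it does not affect the
rest of the scan.

Words of height at most `k` are well-quasi-ordered by reduction, by induction on `k`. Such a word is
a concatenation of arches: level letters, and words (East, North) `v` (North, East) where `v` has
height at most `k - 1` (`PathWord.descends_of_height`). Arches are well-quasi-ordered by induction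
and reduce to the empty word, so that Higman's lemma for lists of arches gives the claim for
concatenations (`PathWord.concatenations_partiallyWellOrderedOn`). An arch is removed only where the
word stays above the height at its ends, which is why the removal yields a minor even though the
intervals that are open there remain.
-/

/-! ### Transversals of interval families -/

/-- The number of elements of `I` among the first `t` elements of `Fin n`. -/
noncomputable def countBelow {n : ℕ} (I : Set (Fin n)) (t : ℕ) : ℕ := by
  classical exact Nat.count (fun x => ∃ h : x < n, (⟨x, h⟩ : Fin n) ∈ I) t

theorem countBelow_zero {n : ℕ} (I : Set (Fin n)) : countBelow I 0 = 0 := by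
  simp [countBelow]

theorem countBelow_mono {n : ℕ} (I : Set (Fin n)) : Monotone (countBelow I) := by
  classical exact Nat.count_monotone _

open Classical in
theorem countBelow_succ {n : ℕ} (I : Set (Fin n)) (t : ℕ) :
    countBelow I (t + 1) =
      countBelow I t + if ∃ h : t < n, (⟨t, h⟩ : Fin n) ∈ I then 1 else 0 := by
  simp only [countBelow]
  rw [Nat.count_succ]

/-- Hall's condition for a family of intervals whose left and right ends both increase: only the
windows `[s, t)` have to be tested. Here `q t` counts the intervals starting before `t`, and
`p s` those ending before `s`, so that `q t - p s` intervals meet the window. -/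
theorem isPartialTransversal_iff_windows {n r : ℕ} {p q : ℕ → ℕ} (hp : Monotone p)
    (hq : Monotone q) (hpq : ∀ t, p t ≤ q t) (hqr : ∀ t, q t ≤ r) (A : Fin r → Set (Fin n))
    (hA : ∀ x j, x ∈ A j ↔ p x ≤ j ∧ (j : ℕ) < q (x + 1)) (I : Set (Fin n)) :
    IsPartialTransversal A I ↔
      ∀ s t, s ≤ t → p s + countBelow I t ≤ q t + countBelow I s := by
  classical
  constructor
  · rintro ⟨f, hf, hfA⟩ s t hst
    obtain ⟨b, rfl⟩ := Nat.exists_eq_add_of_le hst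
    have hcount : countBelow I (s + b) ≤ countBelow I s + (q (s + b) - p s) := by
      have h1 : countBelow I (s + b) = countBelow I s +
          ((Finset.range b).filter
            fun k => ∃ h : s + k < n, (⟨s + k, h⟩ : Fin n) ∈ I).card := by
        simp only [countBelow]
        rw [Nat.count_add]
        congr 1
        convert Nat.count_eq_card_filter_range _ _
      rw [h1, ← Nat.card_Ico]
      refine Nat.add_le_add_left (Finset.card_le_card_of_injOn
        (fun k => if h : ∃ h : s + k < n, (⟨s + k, h⟩ : Fin n) ∈ I
          then (f ⟨⟨s + k, h.1⟩, h.2⟩ : ℕ) else 0) ?_ ?_) _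
      · intro k hk
        obtain ⟨hkb, hk⟩ := Finset.mem_filter.1 hk
        have := (hA _ _).1 (hfA ⟨⟨s + k, hk.1⟩, hk.2⟩)
        simp only [dif_pos hk]
        rw [Finset.mem_coe, Finset.mem_Ico]
        exact ⟨(hp (Nat.le_add_right s k)).trans this.1,
          this.2.trans_le (hq (by have := Finset.mem_range.1 hkb; simp only; omega))⟩
      · intro k hk l hl hkl
        have hk := (Finset.mem_filter.1 hk).2
        have hl := (Finset.mem_filter.1 hl).2
        simp only [dif_pos hk, dif_pos hl] at hkl
        have := hf (Fin.ext hkl)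
        simp only [Subtype.mk.injEq, Fin.mk.injEq] at this
        omega
    have h2 : p s ≤ q (s + b) := (hpq s).trans (hq hst)
    omega
  · intro h
    -- The greedy matching, in closed form: the number of intervals that are matched or have
    -- expired before `x`.
    let g : ℕ → ℕ := fun x =>
      (Finset.range (x + 1)).sup fun s => p s + (countBelow I x - countBelow I s)
    have hsucc : ∀ x : I, countBelow I ((x : Fin n) + 1) = countBelow I (x : Fin n) + 1 := by
      intro x
      rw [countBelow_succ, if_pos ⟨x.1.2, x.2⟩]
    have hg : ∀ x : I, g (x : Fin n) < q ((x : Fin n) + 1) := by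
      intro x
      rw [Finset.sup_lt_iff]
      · intro s hs
        have hs : s ≤ (x : Fin n) := Nat.lt_succ_iff.1 (Finset.mem_range.1 hs)
        have h1 := h s ((x : Fin n) + 1) (by omega)
        have h2 := countBelow_mono I hs
        have h3 := hsucc x
        omega
      · have h1 := h 0 ((x : Fin n) + 1) (Nat.zero_le _)
        rw [hsucc x, countBelow_zero] at h1
        rw [bot_eq_zero]
        omega
    have hmono : ∀ x y : I, (x : Fin n) < (y : Fin n) → g (x : Fin n) < g (y : Fin n) := by
      intro x y hxy
      have hxy' : ((x : Fin n) : ℕ) + 1 ≤ (y : Fin n) := hxy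
      have h3 := hsucc x
      have h4 := countBelow_mono I hxy'
      rw [← Nat.succ_le_iff, Nat.succ_eq_add_one]
      have : ∀ s ∈ Finset.range ((x : Fin n) + 1),
          p s + (countBelow I (x : Fin n) - countBelow I s) + 1 ≤ g (y : Fin n) := by
        intro s hs
        have hs := Finset.mem_range.1 hs
        refine le_trans ?_ (Finset.le_sup (Finset.mem_range.2 (by omega : s < (y : Fin n) + 1)))
        have := countBelow_mono I (Nat.lt_succ_iff.1 hs)
        omega
      obtain ⟨s, hs, hs'⟩ := Finset.exists_mem_eq_sup (Finset.range ((x : Fin n) + 1)) ⟨0, by simp⟩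
        fun s => p s + (countBelow I (x : Fin n) - countBelow I s)
      exact (congrArg (· + 1) hs').trans_le (this s hs)
    refine ⟨fun x => ⟨g (x : Fin n), (hg x).trans_le (hqr _)⟩, ?_, ?_⟩
    · intro x y hxy
      have hxy : g (x : Fin n) = g (y : Fin n) := congrArg Fin.val hxy
      rcases lt_trichotomy (x : Fin n) (y : Fin n) with h1 | h1 | h1
      · exact absurd hxy (hmono x y h1).ne
      · exact Subtype.ext h1
      · exact absurd hxy (hmono y x h1).ne'
    · intro x
      refine (hA _ _).2 ⟨?_, hg x⟩
      refine le_trans ?_ (Finset.le_sup (f := fun s => p s + (countBelow I (x : Fin n) -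
        countBelow I s)) (Finset.self_mem_range_succ _))
      simp

namespace LatticePath

theorem northCount_eq_count (P : LatticePath) (t : ℕ) :
    P.northCount t = Nat.count (fun x : ℕ => P[x]? = some Step.north) t := by
  induction t with
  | zero => simp [northCount]
  | succ t ih =>
    rw [Nat.count_succ, ← ih, northCount, northCount, List.take_add_one, List.count_append]
    rcases P[t]? with _ | x
    · simp
    · cases x <;> simp

theorem northCount_mono (P : LatticePath) : Monotone P.northCount := fun s t h => by
  simp only [northCount_eq_count]
  exact Nat.count_monotone _ h

theorem northCount_le (P : LatticePath) (t : ℕ) : P.northCount t ≤ P.count Step.north :=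
  (List.take_sublist t P).count_le _

theorem count_northPos {P : LatticePath} {j : ℕ} (hj : j < P.count Step.north) :
    P.northCount (P.northPos j) = j ∧ P.northCount (P.northPos j + 1) = j + 1 := by
  have h : ∀ hf : (Set.ofPred fun x : ℕ => P[x]? = some Step.north).Finite,
      j < hf.toFinset.card := by
    intro hf
    refine hj.trans_le ?_
    have := Nat.count_le_card hf P.length
    rwa [← northCount_eq_count, northCount, List.take_length] at this
  rw [northCount_eq_count, northCount_eq_count]
  exact ⟨Nat.count_nth h, Nat.count_nth_succ h⟩

theorem northPos_le_iff {P : LatticePath} {j : ℕ} (hj : j < P.count Step.north) (x : ℕ) :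
    P.northPos j ≤ x ↔ j < P.northCount (x + 1) := by
  obtain ⟨h1, h2⟩ := count_northPos hj
  constructor
  · intro h
    have := P.northCount_mono (Nat.succ_le_succ h)
    simp only [Nat.succ_eq_add_one] at this
    omega
  · intro h
    by_contra! hlt
    have := P.northCount_mono (Nat.succ_le_of_lt hlt)
    simp only [Nat.succ_eq_add_one] at this
    omega

theorem le_northPos_iff {P : LatticePath} {j : ℕ} (hj : j < P.count Step.north) (x : ℕ) :
    x ≤ P.northPos j ↔ P.northCount x ≤ j := by
  obtain ⟨h1, h2⟩ := count_northPos hj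
  constructor
  · intro h
    have := P.northCount_mono h
    omega
  · intro h
    by_contra! hlt
    have := P.northCount_mono (Nat.succ_le_of_lt hlt)
    simp only [Nat.succ_eq_add_one] at this
    omega

end LatticePath

theorem PathPresentation.indep_iff_windows {m r : ℕ} (S : PathPresentation m r)
    (I : Set (Fin (m + r))) :
    S.matroid.Indep I ↔ ∀ s t, s ≤ t →
      S.lower.northCount s + countBelow I t ≤ S.upper.northCount t + countBelow I s := by
  refine (transversalMatroid_indep _ _).trans (isPartialTransversal_iff_windows
    S.lower.northCount_mono S.upper.northCount_mono S.lower_le_upper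
    (fun t => (S.upper.northCount_le t).trans_eq S.upper_north) _ (fun x j => ?_) I)
  rw [← LatticePath.northPos_le_iff (by rw [S.upper_north]; exact j.2),
    ← LatticePath.le_northPos_iff (by rw [S.lower_north]; exact j.2)]
  exact and_comm

/-! ### Isomorphisms and minors -/

theorem MatroidIso.refl {α : Type*} (M : Matroid α) : MatroidIso M M :=
  ⟨Equiv.refl _, fun I => by simp⟩

theorem MatroidIso.symm {α β : Type*} {M : Matroid α} {N : Matroid β} (h : MatroidIso M N) :
    MatroidIso N M := by
  obtain ⟨e, he⟩ := h
  refine ⟨e.symm, fun I => ?_⟩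
  rw [he, ← Set.image_comp e e.symm]
  simp

theorem MatroidIso.trans {α β γ : Type*} {M : Matroid α} {N : Matroid β} {K : Matroid γ}
    (h : MatroidIso M N) (h' : MatroidIso N K) : MatroidIso M K := by
  obtain ⟨e, he⟩ := h
  obtain ⟨f, hf⟩ := h'
  refine ⟨e.trans f, fun I => ?_⟩
  rw [he, hf, ← Set.image_comp f e]
  rfl

/-- Every minor arises by contracting an independent set, so that its independent sets can be
described through those of the whole matroid. -/
theorem Matroid.IsMinor.exists_indep_contract {α : Type*} {M N : Matroid α} (h : N.IsMinor M) :
    ∃ C, M.Indep C ∧ C ⊆ M.E \ N.E ∧ ∀ J ⊆ N.E, N.Indep J ↔ M.Indep (J ∪ C) := by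
  obtain ⟨C, D, hC, -, hCD, rfl⟩ := h.exists_eq_contract_delete_disjoint
  obtain ⟨B, hB⟩ := M.exists_isBasis C
  refine ⟨B, hB.indep, fun x hx => ⟨hC (hB.subset hx), fun hx' => ?_⟩, fun J hJ => ?_⟩
  · exact hx'.1.2 (hB.subset hx)
  · have hJC : Disjoint C J := Set.disjoint_left.2 fun x hx hxJ => (hJ hxJ).1.2 hx
    have hJD : Disjoint J D := Set.disjoint_left.2 fun x hxJ hx => (hJ hxJ).2 hx
    rw [delete_indep_iff, hB.contract_indep_iff]
    tauto

/-- A minor is determined, inside the larger matroid, by its ground set and the independent set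
that is contracted; the remaining elements are deleted. -/
theorem Matroid.Indep.exists_minor {α : Type*} {M : Matroid α} {C X : Set α} (hC : M.Indep C)
    (hX : X ⊆ M.E \ C) :
    ∃ N : Matroid α, N.IsMinor M ∧ N.E = X ∧ ∀ J ⊆ X, N.Indep J ↔ M.Indep (J ∪ C) := by
  refine ⟨(M.contract C).delete ((M.E \ C) \ X), ⟨_, _, rfl⟩, ?_, fun J hJ => ?_⟩
  · rw [delete_ground, contract_ground, Set.sdiff_sdiff_cancel_left hX]
  · have h1 : Disjoint J ((M.E \ C) \ X) :=
      Set.disjoint_left.2 fun x hx hx' => hx'.2 (hJ hx)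
    have h2 : Disjoint J C := Set.disjoint_left.2 fun x hx hx' => (hX (hJ hx)).2 hx'
    rw [delete_indep_iff, hC.contract_indep_iff]
    tauto

theorem MatroidIso.exists_isMinor {α β : Type*} {M M' : Matroid α} {N : Matroid β}
    (h : MatroidIso M N) (hM : M'.IsMinor M) :
    ∃ N' : Matroid β, N'.IsMinor N ∧ MatroidIso M' N' := by
  obtain ⟨e, he⟩ := h
  obtain ⟨C, hC, hCE, hI⟩ := hM.exists_indep_contract
  have hsub : M'.E ⊆ M.E := hM.subset
  -- The image under `e` of a set of elements of `M`.
  let im : Set α → Set β := fun X => Subtype.val '' (e '' (Subtype.val ⁻¹' X))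
  have him : ∀ X ⊆ M.E, M.Indep X ↔ N.Indep (im X) := by
    intro X hX
    rw [← he, Subtype.image_preimage_coe, Set.inter_eq_self_of_subset_right hX]
  have hunion : ∀ X Y, im (X ∪ Y) = im X ∪ im Y := by
    intro X Y
    simp only [im, Set.preimage_union, Set.image_union]
  have hmem : ∀ X (x : M.E), (e x : β) ∈ im X ↔ (x : α) ∈ X := by
    intro X x
    simp only [im]
    rw [Subtype.val_injective.mem_set_image, e.injective.mem_set_image]
    rfl
  have himE : ∀ X, im X ⊆ N.E := by
    rintro X _ ⟨y, -, rfl⟩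
    exact y.2
  have hCN : N.Indep (im C) := (him C hC.subset_ground).1 hC
  have hX : im M'.E ⊆ N.E \ im C := by
    rintro _ ⟨_, ⟨x, hx, rfl⟩, rfl⟩
    refine ⟨(e x).2, fun hx' => ?_⟩
    exact (hCE ((hmem C x).1 hx')).2 hx
  obtain ⟨N', hN', hE, hI'⟩ := hCN.exists_minor hX
  let f : M'.E ≃ N'.E := Equiv.ofBijective
    (fun x => ⟨e ⟨x, hsub x.2⟩, by rw [hE]; exact (hmem _ _).2 x.2⟩) (by
      constructor
      · intro x y hxy
        have := e.injective (Subtype.ext (Subtype.mk.inj hxy))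
        exact Subtype.ext (Subtype.mk.inj this)
      · rintro ⟨y, hy⟩
        rw [hE] at hy
        obtain ⟨_, ⟨x, hx, rfl⟩, rfl⟩ := hy
        exact ⟨⟨x, hx⟩, rfl⟩)
  refine ⟨N', hN', f, fun J => ?_⟩
  have hJ : Subtype.val '' J ⊆ M'.E := by
    rintro _ ⟨x, -, rfl⟩
    exact x.2
  have hfJ : Subtype.val '' (f '' J) = im (Subtype.val '' J) := by
    ext y
    constructor
    · rintro ⟨_, ⟨x, hx, rfl⟩, rfl⟩
      exact (hmem _ _).2 ⟨x, hx, rfl⟩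
    · rintro ⟨_, ⟨x, ⟨z, hz, hzx⟩, rfl⟩, rfl⟩
      refine ⟨f z, ⟨z, hz, rfl⟩, ?_⟩
      change ((e ⟨z, _⟩ : N.E) : β) = e x
      congr 2
      exact Subtype.ext hzx
  rw [hI _ hJ, him _ (Set.union_subset (hJ.trans hsub) hC.subset_ground), hunion, hfJ,
    hI' _ (by rw [← hfJ, ← hE]; rintro _ ⟨y, -, rfl⟩; exact y.2)]

theorem MatroidIso.isMinorUpToIso {α β : Type*} {M : Matroid α} {N : Matroid β}
    (h : MatroidIso M N) : IsMinorUpToIso M N :=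
  ⟨N, Matroid.IsMinor.refl, h⟩

theorem IsMinorUpToIso.trans {α β γ : Type*} {M : Matroid α} {N : Matroid β} {K : Matroid γ}
    (h : IsMinorUpToIso M N) (h' : IsMinorUpToIso N K) : IsMinorUpToIso M K := by
  obtain ⟨N', hN', hMN⟩ := h
  obtain ⟨K', hK', hNK⟩ := h'
  obtain ⟨K'', hK'', hNK'⟩ := hNK.exists_isMinor hN'
  exact ⟨K'', hK''.trans hK', hMN.trans hNK'⟩

/-! ### Words of steps and their reductions -/

/-- A pair of lattice paths of equal length, read in parallel: the letter `(p, q)` consists of a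
step `p` of the lower and a step `q` of the upper path. -/
abbrev PathWord : Type := List (Step × Step)

/-- The change of height, `0` or `1`, along a step. -/
def Step.rise : Step → ℤ
  | east => 0
  | north => 1

/-- `PathWord.Reduction v w`: the word `v` arises from `w` by an elementary reduction. On the
matroids, `dropEast` and `merge` are deletions and `dropNorth` is a contraction, each of a single
element. -/
inductive PathWord.Reduction : PathWord → PathWord → Prop
  | dropEast (X Y : PathWord) : Reduction (X ++ Y) (X ++ (.east, .east) :: Y)
  | dropNorth (X Y : PathWord) : Reduction (X ++ Y) (X ++ (.north, .north) :: Y)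
  | merge (X Y : PathWord) :
      Reduction (X ++ (.north, .north) :: Y) (X ++ (.east, .north) :: (.north, .east) :: Y)

/-- `v` arises from `w` by a sequence of elementary reductions. -/
abbrev PathWord.Reduces : PathWord → PathWord → Prop :=
  Relation.ReflTransGen PathWord.Reduction

namespace PathWord

theorem Reduction.append_context {v w : PathWord} (h : Reduction v w) (X Y : PathWord) :
    Reduction (X ++ v ++ Y) (X ++ w ++ Y) := by
  cases h with
  | dropEast A B => simpa using Reduction.dropEast (X ++ A) (B ++ Y)
  | dropNorth A B => simpa using Reduction.dropNorth (X ++ A) (B ++ Y)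
  | merge A B => simpa using Reduction.merge (X ++ A) (B ++ Y)

theorem Reduces.append_context {v w : PathWord} (h : Reduces v w) (X Y : PathWord) :
    Reduces (X ++ v ++ Y) (X ++ w ++ Y) :=
  h.lift (fun u => X ++ u ++ Y) fun _ _ h => h.append_context X Y

theorem Reduces.append {v w v' w' : PathWord} (h : Reduces v w) (h' : Reduces v' w') :
    Reduces (v ++ v') (w ++ w') := by
  have h1 := h.append_context [] v'
  have h2 := h'.append_context w []
  simp only [List.nil_append, List.append_nil] at h1 h2
  exact h1.trans h2

/-! ### Words of bounded height are well-quasi-ordered by reduction -/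

/-- The concatenations of words from `s`. -/
def concatenations (s : Set PathWord) : Set PathWord :=
  {w | ∃ L : List PathWord, (∀ v ∈ L, v ∈ s) ∧ L.flatten = w}

/-- The nonempty words that return to their initial height at the end, but not before, never go
below that height and exceed it by at most `n`. -/
def arches : ℕ → Set PathWord
  | 0 => {[(.east, .east)], [(.north, .north)]}
  | n + 1 => {[(.east, .east)], [(.north, .north)]} ∪
      (fun v => (.east, .north) :: (v ++ [(.north, .east)])) '' concatenations (arches n)

theorem nil_mem_concatenations (s : Set PathWord) : [] ∈ concatenations s :=
  ⟨[], by simp, rfl⟩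

theorem append_mem_concatenations {s : Set PathWord} {v w : PathWord} (hv : v ∈ s)
    (hw : w ∈ concatenations s) : v ++ w ∈ concatenations s := by
  obtain ⟨L, hL, rfl⟩ := hw
  exact ⟨v :: L, by simpa using ⟨hv, hL⟩, rfl⟩

theorem flat_mem_arches (n : ℕ) (p : Step) : [(p, p)] ∈ arches n := by
  cases n <;> cases p <;> simp [arches]

theorem arch_mem_arches {n : ℕ} {v : PathWord} (hv : v ∈ concatenations (arches n)) :
    (.east, .north) :: (v ++ [(.north, .east)]) ∈ arches (n + 1) :=
  Or.inr ⟨v, hv, rfl⟩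

theorem nil_reduces_concatenation {s : Set PathWord} (hs : ∀ v ∈ s, Reduces [] v) {w : PathWord}
    (hw : w ∈ concatenations s) : Reduces [] w := by
  obtain ⟨L, hL, rfl⟩ := hw
  induction L with
  | nil => exact .refl
  | cons v L ih =>
    exact Reduces.append (v := []) (v' := []) (hs v (hL v (by simp)))
      (ih fun u hu => hL u (by simp [hu]))

theorem nil_reduces_flat (p : Step) : Reduces [] [(p, p)] := by
  cases p
  · exact .single (Reduction.dropEast [] [])
  · exact .single (Reduction.dropNorth [] [])

theorem reduces_arch {v w : PathWord} (h : Reduces v w) :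
    Reduces ((.east, .north) :: (v ++ [(.north, .east)]))
      ((.east, .north) :: (w ++ [(.north, .east)])) := by
  simpa using h.append_context [(.east, .north)] [(.north, .east)]

theorem nil_reduces_of_mem_arches {n : ℕ} {w : PathWord} (hw : w ∈ arches n) : Reduces [] w := by
  induction n generalizing w with
  | zero =>
    rcases hw with rfl | rfl
    · exact nil_reduces_flat _
    · exact nil_reduces_flat _
  | succ n ih =>
    rcases hw with (rfl | rfl) | ⟨v, hv, rfl⟩
    · exact nil_reduces_flat _
    · exact nil_reduces_flat _
    · exact ((nil_reduces_flat .north).tail (Reduction.merge [] [])).trans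
        (reduces_arch (nil_reduces_concatenation (fun u hu => ih hu) hv))

/-- Higman's lemma, transferred from lists of words to their concatenations. -/
theorem concatenations_partiallyWellOrderedOn {s : Set PathWord} (hs : ∀ v ∈ s, Reduces [] v)
    (h : s.PartiallyWellOrderedOn Reduces) :
    (concatenations s).PartiallyWellOrderedOn Reduces := by
  have himage : concatenations s = List.flatten '' {L : List PathWord | ∀ v ∈ L, v ∈ s} := rfl
  rw [himage]
  refine (Set.PartiallyWellOrderedOn.partiallyWellOrderedOn_sublistForall₂ _ h).image_of_monotone_on
    fun K _ L hL hKL => ?_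
  induction hKL with
  | nil => exact nil_reduces_concatenation hs ⟨_, hL, rfl⟩
  | cons hab _ ih => exact hab.append (ih (by simp_all) (by simp_all))
  | @cons_right b K L _ ih =>
    exact Reduces.append (v := []) (hs b (hL b (by simp))) (ih (by assumption) (by simp_all))

theorem arches_partiallyWellOrderedOn (n : ℕ) : (arches n).PartiallyWellOrderedOn Reduces := by
  induction n with
  | zero =>
    exact Set.Finite.partiallyWellOrderedOn
      (Set.toFinite {[(Step.east, Step.east)], [(Step.north, Step.north)]})
  | succ n ih =>
    exact (Set.toFinite _).partiallyWellOrderedOn.union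
      ((concatenations_partiallyWellOrderedOn (fun _ => nil_reduces_of_mem_arches)
        ih).image_of_monotone_on fun _ _ _ _ h => reduces_arch h)

/-- A word that descends from height `d` to height `0`, split where it first reaches each of the
heights `d - 1, …, 0`; `n` bounds how far it rises above `d`. -/
def Descends : ℕ → ℕ → PathWord → Prop
  | n, 0, w => w ∈ concatenations (arches n)
  | n, d + 1, w => ∃ v ∈ concatenations (arches n), ∃ w', w = v ++ (.north, .east) :: w' ∧
      Descends (n + 1) d w'

theorem Descends.append {n d : ℕ} {u w : PathWord} (hu : u ∈ arches n) (h : Descends n d w) :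
    Descends n d (u ++ w) := by
  cases d with
  | zero => exact append_mem_concatenations hu h
  | succ d =>
    obtain ⟨v, hv, w', rfl, h'⟩ := h
    exact ⟨u ++ v, append_mem_concatenations hu hv, w', by simp, h'⟩

/-- The distance of the upper from the lower path after `t` steps. -/
def height (w : PathWord) (t : ℕ) : ℤ :=
  ((w.take t).map fun x => x.2.rise - x.1.rise).sum

theorem height_zero (w : PathWord) : height w 0 = 0 := by
  simp [height]

theorem height_cons_succ (x : Step × Step) (w : PathWord) (t : ℕ) :
    height (x :: w) (t + 1) = x.2.rise - x.1.rise + height w t := by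
  simp [height]

theorem descends_of_height {w : PathWord} {n d : ℕ} (h0 : ∀ t, 0 ≤ d + height w t)
    (hn : ∀ t, height w t ≤ n) (hw : d + height w w.length = 0) : Descends n d w := by
  induction w generalizing n d with
  | nil =>
    rw [List.length_nil, height_zero] at hw
    obtain rfl : d = 0 := by omega
    exact nil_mem_concatenations _
  | cons x w ih =>
    have h0' := fun t => h0 (t + 1)
    have hn' := fun t => hn (t + 1)
    rw [List.length_cons, height_cons_succ] at hw
    simp only [height_cons_succ] at h0' hn'
    obtain ⟨p, q⟩ := x
    cases p <;> cases q <;> simp only [Step.rise] at h0' hn' hw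
    · refine Descends.append (flat_mem_arches n .east) (ih ?_ ?_ ?_)
      · simpa using h0'
      · simpa using hn'
      · simpa using hw
    · -- The word rises: its first return to height `d` completes an arch.
      have h1 := hn' 0
      rw [height_zero] at h1
      obtain ⟨n, rfl⟩ := Nat.exists_eq_succ_of_ne_zero (by omega : n ≠ 0)
      obtain ⟨v, hv, w', rfl, h'⟩ : Descends n (d + 1) w :=
        ih (fun t => by have := h0' t; push_cast; omega)
          (fun t => by have := hn' t; push_cast at this; omega) (by push_cast; omega)
      simpa using h'.append (arch_mem_arches hv)
    · have h1 := h0' 0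
      rw [height_zero] at h1
      obtain ⟨d, rfl⟩ := Nat.exists_eq_succ_of_ne_zero (by omega : d ≠ 0)
      refine ⟨[], nil_mem_concatenations _, w, rfl, ih ?_ ?_ ?_⟩
      · intro t
        have := h0' t
        push_cast at this
        omega
      · intro t
        have := hn' t
        push_cast
        omega
      · push_cast at hw
        omega
    · refine Descends.append (flat_mem_arches n .north) (ih ?_ ?_ ?_)
      · simpa using h0'
      · simpa using hn'
      · simpa using hw

end PathWord

/-! ### Matroids presented by labelled words -/

/-- The greedy matching of `I`, scanning the list `L` of labelled letters from left to right, never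
fails. Here `d` is the number of intervals that are open when the scan starts (the height of the
word) and `a` the number of those that are not matched yet. Open intervals are matched in the order
in which they close, so that the unmatched ones are the last to close; hence the minimum. -/
def Feasible {α : Type*} (I : Set α) : List (α × Step × Step) → ℤ → ℤ → Prop
  | [], _, _ => True
  | (x, p, q) :: L, d, a =>
    0 ≤ min (a + q.rise - I.indicator (fun _ => 1) x) (d + q.rise - p.rise) ∧
      Feasible I L (d + q.rise - p.rise)
        (min (a + q.rise - I.indicator (fun _ => 1) x) (d + q.rise - p.rise))

namespace Feasible

variable {α β : Type*}

theorem congr_forall₂ {I : Set α} {J : Set β} {L : List (α × Step × Step)}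
    {K : List (β × Step × Step)}
    (h : List.Forall₂ (fun x y => x.2 = y.2 ∧ (x.1 ∈ I ↔ y.1 ∈ J)) L K) (d a : ℤ) :
    Feasible I L d a ↔ Feasible J K d a := by
  induction h generalizing d a with
  | nil => exact Iff.rfl
  | @cons x y L K hxy _ ih =>
    obtain ⟨x, p, q⟩ := x
    obtain ⟨y, p', q'⟩ := y
    obtain ⟨h1, h2⟩ := hxy
    simp only [Prod.mk.injEq] at h1 h2
    obtain ⟨rfl, rfl⟩ := h1
    by_cases hx : x ∈ I
    · simp only [Feasible, Set.indicator_of_mem hx, Set.indicator_of_mem (h2.1 hx), ih]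
    · simp only [Feasible, Set.indicator_of_notMem hx, Set.indicator_of_notMem (mt h2.2 hx), ih]

theorem congr_set {I J : Set α} {L : List (α × Step × Step)}
    (h : ∀ x ∈ L.map Prod.fst, x ∈ I ↔ x ∈ J) (d a : ℤ) :
    Feasible I L d a ↔ Feasible J L d a :=
  congr_forall₂ (List.forall₂_same.2 fun _ hx => ⟨rfl, h _ (List.mem_map_of_mem hx)⟩) d a

theorem append_congr {I J : Set α} {X Y Z : List (α × Step × Step)}
    (hX : ∀ y ∈ X.map Prod.fst, y ∈ I ↔ y ∈ J)
    (h : ∀ d a, 0 ≤ a → a ≤ d → (Feasible I Y d a ↔ Feasible J Z d a)) {d a : ℤ} (ha : 0 ≤ a)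
    (hd : a ≤ d) : Feasible I (X ++ Y) d a ↔ Feasible J (X ++ Z) d a := by
  induction X generalizing d a with
  | nil => exact h d a ha hd
  | cons x X ih =>
    obtain ⟨x, p, q⟩ := x
    have hxIJ := hX x (by simp)
    have ih := fun {d a : ℤ} => @ih (fun y hy => hX y (by simp_all)) d a
    by_cases hx : x ∈ I
    · simp only [List.cons_append, Feasible, Set.indicator_of_mem hx,
        Set.indicator_of_mem (hxIJ.1 hx)]
      exact and_congr_right fun h0 => ih h0 (min_le_right _ _)
    · simp only [List.cons_append, Feasible, Set.indicator_of_notMem hx,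
        Set.indicator_of_notMem (mt hxIJ.2 hx)]
      exact and_congr_right fun h0 => ih h0 (min_le_right _ _)

/-- For the empty set the number of unmatched intervals never runs out, so that its initial value
does not matter. -/
theorem empty_append_mono {X Y Z : List (α × Step × Step)}
    (h : ∀ d a b, 0 ≤ b → Feasible ∅ Y d a → Feasible ∅ Z d b) {d a b : ℤ} (hb : 0 ≤ b)
    (hY : Feasible ∅ (X ++ Y) d a) : Feasible ∅ (X ++ Z) d b := by
  induction X generalizing d a b with
  | nil => exact h d a b hb hY
  | cons x X ih =>
    obtain ⟨x, p, q⟩ := x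
    have hq : 0 ≤ q.rise := by cases q <;> simp [Step.rise]
    simp only [List.cons_append, Feasible, Set.indicator_empty] at hY ⊢
    have h1 : 0 ≤ min (b + q.rise - 0) (d + q.rise - p.rise) :=
      le_min (by omega) (hY.1.trans (min_le_right _ _))
    exact ⟨h1, ih h1 hY.2⟩

end Feasible

/-- The matroid `M` is presented by the list `L` of its elements, each labelled with the steps of
the lower and of the upper path at its position. -/
structure Presents {α : Type*} (L : List (α × Step × Step)) (M : Matroid α) : Prop where
  nodup : (L.map Prod.fst).Nodup
  ground : M.E = {x | x ∈ L.map Prod.fst}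
  indep_iff : ∀ I ⊆ M.E, M.Indep I ↔ Feasible I L 0 0

namespace Presents

variable {α β : Type*}

/-- The word determines the matroid up to isomorphism. -/
theorem matroidIso {L : List (α × Step × Step)} {K : List (β × Step × Step)} {M : Matroid α}
    {N : Matroid β} (hM : Presents L M) (hN : Presents K N)
    (h : L.map Prod.snd = K.map Prod.snd) : MatroidIso M N := by
  classical
  have hlen : L.length = K.length := by simpa using congrArg List.length h
  have hlen' : (L.map Prod.fst).length = (K.map Prod.fst).length := by simpa using hlen
  let e : M.E ≃ N.E := (Equiv.setCongr hM.ground).trans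
    (((hM.nodup.getEquiv _).symm.trans (finCongr hlen')).trans
      ((hN.nodup.getEquiv _).trans (Equiv.setCongr hN.ground.symm)))
  have he : ∀ (i : ℕ) (hi : i < L.length) (hi' : i < K.length) (hx : L[i].1 ∈ M.E),
      (e ⟨L[i].1, hx⟩ : β) = K[i].1 := by
    intro i hi hi' hx
    have h1 : (hM.nodup.getEquiv _).symm ⟨L[i].1, by rw [hM.ground] at hx; exact hx⟩ =
        ⟨i, by simpa using hi⟩ := by
      rw [Equiv.symm_apply_eq]
      ext
      simp
    simp only [e, Equiv.trans_apply, Equiv.setCongr_apply]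
    rw [h1]
    change (K.map Prod.fst)[i]'(by simpa using hi') = _
    simp
  refine ⟨e, fun I => ?_⟩
  rw [hM.indep_iff _ (by rintro _ ⟨x, -, rfl⟩; exact x.2),
    hN.indep_iff _ (by rintro _ ⟨x, -, rfl⟩; exact x.2)]
  refine Feasible.congr_forall₂ (List.forall₂_iff_get.2 ⟨hlen, fun i hi hi' => ⟨?_, ?_⟩⟩) 0 0
  · have := congrArg (fun l => l[i]?) h
    simpa [hi, hi'] using this
  · have hx : L[i].1 ∈ M.E := by
      rw [hM.ground]
      exact List.mem_map_of_mem (List.getElem_mem hi)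
    rw [List.get_eq_getElem, List.get_eq_getElem, ← he i hi hi' hx,
      Subtype.val_injective.mem_set_image, e.injective.mem_set_image]
    exact Subtype.val_injective.mem_set_image (s := I) (a := ⟨L[i].1, hx⟩)

theorem delete {L K : List (α × Step × Step)} {M : Matroid α} (h : Presents L M) {x : α}
    (hL : (L.map Prod.fst).Perm (x :: K.map Prod.fst))
    (hI : ∀ I : Set α, x ∉ I → (Feasible I L 0 0 ↔ Feasible I K 0 0)) :
    Presents K (M.delete {x}) := by
  have hn := hL.nodup_iff.1 h.nodup
  rw [List.nodup_cons] at hn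
  refine ⟨hn.2, ?_, fun I hIE => ?_⟩
  · ext y
    rw [Matroid.delete_ground, h.ground]
    simp only [Set.mem_sdiff, Set.mem_ofPred_eq, hL.mem_iff, List.mem_cons, Set.mem_singleton_iff]
    constructor
    · tauto
    · intro hy
      exact ⟨Or.inr hy, by rintro rfl; exact hn.1 hy⟩
  · have hx : x ∉ I := fun hx => (hIE hx).2 rfl
    rw [Matroid.deleteElem_indep_iff, h.indep_iff _ (hIE.trans Set.sdiff_subset), hI I hx]
    tauto

theorem contract {L K : List (α × Step × Step)} {M : Matroid α} (h : Presents L M) {x : α}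
    (hL : (L.map Prod.fst).Perm (x :: K.map Prod.fst))
    (hI : ∀ I : Set α, x ∉ I → (Feasible (insert x I) L 0 0 ↔ Feasible I K 0 0))
    (hK : Feasible ∅ K 0 0) :
    Presents K (M.contract {x}) := by
  have hn := hL.nodup_iff.1 h.nodup
  rw [List.nodup_cons] at hn
  have hxE : x ∈ M.E := by
    rw [h.ground]
    exact hL.mem_iff.2 (by simp)
  have hx : M.Indep {x} := by
    rw [h.indep_iff _ (by simpa using hxE)]
    simpa using (hI ∅ (by simp)).2 hK
  refine ⟨hn.2, ?_, fun I hIE => ?_⟩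
  · ext y
    rw [Matroid.contract_ground, h.ground]
    simp only [Set.mem_sdiff, Set.mem_ofPred_eq, hL.mem_iff, List.mem_cons, Set.mem_singleton_iff]
    constructor
    · tauto
    · intro hy
      exact ⟨Or.inr hy, by rintro rfl; exact hn.1 hy⟩
  · have hxI : x ∉ I := fun hx => (hIE hx).2 rfl
    rw [hx.contract_indep_iff, Set.union_singleton, h.indep_iff _
      (Set.insert_subset hxE (hIE.trans Set.sdiff_subset)), hI I hxI]
    simpa using fun _ => hxI

/-- An elementary reduction of the word deletes or contracts an element of the matroid. -/
theorem exists_minor_of_reduction {L : List (α × Step × Step)} {M : Matroid α}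
    (h : Presents L M) {v : PathWord} (hv : PathWord.Reduction v (L.map Prod.snd)) :
    ∃ (K : List (α × Step × Step)) (N : Matroid α),
      K.map Prod.snd = v ∧ Presents K N ∧ N.IsMinor M := by
  generalize hw : L.map Prod.snd = w at hv
  cases hv with
  | dropEast X Y =>
    obtain ⟨X, L', rfl, rfl, hL'⟩ := List.map_eq_append_iff.1 hw
    obtain ⟨⟨x, p, q⟩, Y, rfl, hpq, rfl⟩ := List.map_eq_cons_iff.1 hL'
    cases hpq
    refine ⟨X ++ Y, M.delete {x}, by simp, h.delete ?_ fun I hx => ?_, ⟨∅, {x}, by simp⟩⟩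
    · simp
    · refine Feasible.append_congr (fun _ _ => Iff.rfl) (fun d a ha hd => ?_) le_rfl le_rfl
      simp [Feasible, Step.rise, hx, ha, hd]
  | dropNorth X Y =>
    obtain ⟨X, L', rfl, rfl, hL'⟩ := List.map_eq_append_iff.1 hw
    obtain ⟨⟨x, p, q⟩, Y, rfl, hpq, rfl⟩ := List.map_eq_cons_iff.1 hL'
    cases hpq
    have hperm : ((X ++ (x, Step.north, Step.north) :: Y).map Prod.fst).Perm
        (x :: (X ++ Y).map Prod.fst) := by
      simp
    have hxXY := (List.nodup_cons.1 (hperm.nodup_iff.1 h.nodup)).1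
    simp only [List.map_append, List.mem_append, not_or] at hxXY
    have hI : ∀ I : Set α, Feasible (insert x I) (X ++ (x, Step.north, Step.north) :: Y) 0 0 ↔
        Feasible I (X ++ Y) 0 0 := by
      intro I
      refine Feasible.append_congr (fun y hy => ?_) (fun d a ha hd => ?_) le_rfl le_rfl
      · have : y ≠ x := by
          rintro rfl
          exact hxXY.1 hy
        simp [this]
      · have hY : ∀ d a, Feasible (insert x I) Y d a ↔ Feasible I Y d a := by
          refine Feasible.congr_set fun y hy => ?_
          have : y ≠ x := by
            rintro rfl
            exact hxXY.2 hy
          simp [this]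
        simp [Feasible, Step.rise, ha, hd, hY]
    refine ⟨X ++ Y, M.contract {x}, by simp, h.contract hperm (fun I _ => hI I) ?_,
      ⟨{x}, ∅, by simp⟩⟩
    refine Feasible.empty_append_mono (fun d a b hb hY => ?_) le_rfl
      ((h.indep_iff ∅ (Set.empty_subset _)).1 M.empty_indep)
    have hd : d + 1 - 1 = d := by omega
    simp only [Feasible, Step.rise, hd] at hY
    simpa using Feasible.empty_append_mono (X := Y) (Y := []) (Z := []) (by simp [Feasible]) hb
      (by simpa using hY.2)
  | merge X Y =>
    obtain ⟨X, L', rfl, rfl, hL'⟩ := List.map_eq_append_iff.1 hw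
    obtain ⟨⟨x, p, q⟩, L'', rfl, hpq, hL''⟩ := List.map_eq_cons_iff.1 hL'
    obtain ⟨⟨y, p', q'⟩, Y, rfl, hpq', rfl⟩ := List.map_eq_cons_iff.1 hL''
    cases hpq
    cases hpq'
    refine ⟨X ++ (y, .north, .north) :: Y, M.delete {x}, by simp, h.delete ?_ fun I hx => ?_,
      ⟨∅, {x}, by simp⟩⟩
    · simp
    · refine Feasible.append_congr (fun _ _ => Iff.rfl) (fun d a ha hd => ?_) le_rfl le_rfl
      have h0 : 0 ≤ a + 1 := by omega
      have h2 : 0 ≤ d := by omega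
      simp [Feasible, Step.rise, hx, hd, h0, h2]

/-- Every word below the word of `M` is the word of a minor of `M`. -/
theorem exists_minor_of_reduces {L : List (α × Step × Step)} {M : Matroid α}
    (h : Presents L M) {v : PathWord} (hv : PathWord.Reduces v (L.map Prod.snd)) :
    ∃ (K : List (α × Step × Step)) (N : Matroid α),
      K.map Prod.snd = v ∧ Presents K N ∧ N.IsMinor M := by
  induction hv using Relation.ReflTransGen.head_induction_on with
  | refl => exact ⟨L, M, rfl, h, Matroid.IsMinor.refl⟩
  | head huv _ ih =>
    obtain ⟨K, N, hK, hKN, hNM⟩ := ih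
    obtain ⟨K', N', hK', hKN', hNN⟩ := hKN.exists_minor_of_reduction (hK ▸ huv)
    exact ⟨K', N', hK', hKN', hNN.trans hNM⟩

theorem isMinorUpToIso {L : List (α × Step × Step)} {K : List (β × Step × Step)} {M : Matroid α}
    {N : Matroid β} (hM : Presents L M) (hN : Presents K N)
    (h : PathWord.Reduces (L.map Prod.snd) (K.map Prod.snd)) : IsMinorUpToIso M N := by
  obtain ⟨K', N', hK', hKN', hNN⟩ := hN.exists_minor_of_reduces h
  exact ⟨N', hNN, hM.matroidIso hKN' hK'.symm⟩

end Presents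

/-! ### Path presentations as labelled words -/

namespace Feasible

/-- The condition on windows, for a list of letters: no window `[s, t)` contains more elements of
`I` than there are intervals meeting it. -/
theorem iff_windows {α : Type*} {I : Set α} {L : List (α × Step × Step)} {d a : ℤ} (ha : 0 ≤ a)
    (had : a ≤ d) :
    Feasible I L d a ↔
      (∀ t, 0 ≤ a + ((L.take t).map fun x => x.2.2.rise).sum -
        ((L.take t).map fun x => I.indicator (fun _ => (1 : ℤ)) x.1).sum) ∧
      ∀ s t, s ≤ t → 0 ≤ d + ((L.take t).map fun x => x.2.2.rise).sum -
        ((L.take t).map fun x => I.indicator (fun _ => (1 : ℤ)) x.1).sum -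
          (((L.take s).map fun x => x.2.1.rise).sum -
            ((L.take s).map fun x => I.indicator (fun _ => (1 : ℤ)) x.1).sum) := by
  induction L generalizing d a with
  | nil => simp [Feasible, ha, ha.trans had]
  | cons x L ih =>
    obtain ⟨x, p, q⟩ := x
    simp only [Feasible]
    set c : α → ℤ := I.indicator fun _ => 1
    constructor
    · rintro ⟨h0, h⟩
      obtain ⟨h1, h2⟩ := (ih h0 (min_le_right _ _)).1 h
      have h1' : ∀ t, 0 ≤ a + (((x, p, q) :: L).take t |>.map fun x => x.2.2.rise).sum -
          (((x, p, q) :: L).take t |>.map fun x => c x.1).sum := by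
        rintro (_ | t)
        · simpa using ha
        · have := h1 t
          have := min_le_left (a + q.rise - c x) (d + q.rise - p.rise)
          simp only [List.take_succ_cons, List.map_cons, List.sum_cons]
          omega
      refine ⟨h1', ?_⟩
      rintro (_ | s) (_ | t) hst
      · simpa using ha.trans had
      · have := h1' (t + 1)
        simp only [List.take_succ_cons, List.map_cons, List.sum_cons, List.take_zero,
          List.map_nil, List.sum_nil] at this ⊢
        omega
      · omega
      · have := h2 s t (by omega)
        simp only [List.take_succ_cons, List.map_cons, List.sum_cons]
        omega
    · rintro ⟨h1, h2⟩
      have h0 : 0 ≤ min (a + q.rise - c x) (d + q.rise - p.rise) := by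
        have e1 := h1 1
        have e2 := h2 1 1 le_rfl
        simp only [List.take_succ_cons, List.map_cons, List.sum_cons, List.take_zero,
          List.map_nil, List.sum_nil] at e1 e2
        omega
      refine ⟨h0, (ih h0 (min_le_right _ _)).2 ⟨fun t => ?_, fun s t hst => ?_⟩⟩
      · have e1 := h1 (t + 1)
        have e2 := h2 1 (t + 1) (by omega)
        simp only [List.take_succ_cons, List.map_cons, List.sum_cons, List.take_zero,
          List.map_nil, List.sum_nil] at e1 e2
        omega
      · have := h2 (s + 1) (t + 1) (by omega)
        simp only [List.take_succ_cons, List.map_cons, List.sum_cons] at this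
        omega

end Feasible

theorem LatticePath.sum_rise_take (P : LatticePath) (t : ℕ) :
    ((P.take t).map Step.rise).sum = P.northCount t := by
  rw [LatticePath.northCount]
  generalize P.take t = Q
  induction Q with
  | nil => simp
  | cons x Q ih => cases x <;> simp [Step.rise, ih, add_comm]

theorem LatticePath.length_eq (P : LatticePath) :
    P.length = P.count Step.east + P.count Step.north := by
  induction P with
  | nil => simp
  | cons x Q ih =>
    cases x <;> simp only [List.length_cons, ih, List.count_cons_self] <;> simp <;> omega

theorem sum_indicator_take_finRange {n : ℕ} (I : Set (Fin n)) (t : ℕ) :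
    (((List.finRange n).take t).map (I.indicator fun _ => (1 : ℤ))).sum = countBelow I t := by
  classical
  induction t with
  | zero => simp [countBelow_zero]
  | succ t ih =>
    rw [countBelow_succ, List.take_add_one, List.map_append, List.sum_append, ih, Nat.cast_add]
    congr 1
    by_cases ht : t < n
    · by_cases hI : (⟨t, ht⟩ : Fin n) ∈ I <;> simp [ht, hI]
    · simp [ht]

namespace PathPresentation

variable {m r : ℕ} (S : PathPresentation m r)

theorem lower_length : S.lower.length = m + r := by
  rw [LatticePath.length_eq, S.lower_east, S.lower_north]

theorem upper_length : S.upper.length = m + r := by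
  rw [LatticePath.length_eq, S.upper_east, S.upper_north]

/-- The two paths of a presentation, read in parallel. -/
def word : PathWord := S.lower.zip S.upper

theorem map_fst_word : S.word.map Prod.fst = S.lower :=
  List.map_fst_zip (by rw [S.lower_length, S.upper_length])

theorem map_snd_word : S.word.map Prod.snd = S.upper :=
  List.map_snd_zip (by rw [S.lower_length, S.upper_length])

theorem length_word : S.word.length = m + r := by
  rw [← S.lower_length, ← S.map_fst_word, List.length_map]

/-- The word of a presentation, each letter labelled with its position. -/
def labelledWord : List (Fin (m + r) × Step × Step) := (List.finRange (m + r)).zip S.word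

theorem map_fst_labelledWord : S.labelledWord.map Prod.fst = List.finRange (m + r) :=
  List.map_fst_zip (by rw [S.length_word, List.length_finRange])

theorem map_snd_labelledWord : S.labelledWord.map Prod.snd = S.word :=
  List.map_snd_zip (by rw [S.length_word, List.length_finRange])

theorem presents : Presents S.labelledWord S.matroid := by
  refine ⟨?_, ?_, fun I _ => ?_⟩
  · rw [S.map_fst_labelledWord]
    exact List.nodup_finRange _
  · rw [S.map_fst_labelledWord]
    exact Set.ext fun x => iff_of_true trivial (List.mem_finRange x)
  · have hlower : ∀ t, ((S.labelledWord.take t).map fun x => x.2.1.rise).sum =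
        S.lower.northCount t := by
      intro t
      rw [← LatticePath.sum_rise_take, ← S.map_fst_word, ← S.map_snd_labelledWord]
      simp [List.map_take, Function.comp_def]
    have hupper : ∀ t, ((S.labelledWord.take t).map fun x => x.2.2.rise).sum =
        S.upper.northCount t := by
      intro t
      rw [← LatticePath.sum_rise_take, ← S.map_snd_word, ← S.map_snd_labelledWord]
      simp [List.map_take, Function.comp_def]
    have hcount : ∀ t, ((S.labelledWord.take t).map
        fun x => I.indicator (fun _ => (1 : ℤ)) x.1).sum = countBelow I t := by
      intro t
      rw [← sum_indicator_take_finRange, ← S.map_fst_labelledWord]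
      simp [List.map_take, Function.comp_def]
    rw [S.indep_iff_windows, Feasible.iff_windows le_rfl le_rfl]
    simp only [hlower, hupper, hcount]
    constructor
    · intro h
      refine ⟨fun t => ?_, fun s t hst => ?_⟩
      · have := h 0 t (Nat.zero_le _)
        rw [countBelow_zero] at this
        omega
      · have := h s t hst
        omega
    · rintro ⟨-, h⟩ s t hst
      have := h s t hst
      omega

theorem height_word (t : ℕ) :
    S.word.height t = S.upper.northCount t - S.lower.northCount t := by
  rw [← LatticePath.sum_rise_take, ← LatticePath.sum_rise_take, PathWord.height,
    ← S.map_fst_word, ← S.map_snd_word, ← List.map_take, ← List.map_take, List.map_map,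
    List.map_map]
  generalize S.word.take t = w
  induction w with
  | nil => simp
  | cons x w ih =>
    simp only [List.map_cons, List.sum_cons, ih, Function.comp]
    ring

theorem height_word_le_squareWidth (t : ℕ) : S.word.height t ≤ S.squareWidth := by
  rcases Nat.eq_zero_or_pos t with rfl | ht
  · simp [PathWord.height_zero]
  -- Beyond its end the word has the height it ends with.
  wlog htn : t ≤ m + r generalizing t
  · have h : S.word.height t = S.word.height (m + r) := by
      simp only [PathWord.height]
      rw [List.take_of_length_le (by rw [S.length_word]; omega),
        List.take_of_length_le (by rw [S.length_word])]
    rw [h]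
    rcases Nat.eq_zero_or_pos (m + r) with h0 | h0
    · simp [h0, PathWord.height_zero]
    · exact this (m + r) h0 le_rfl
  have h1 := LatticePath.length_eq (S.lower.take t)
  have h2 := LatticePath.length_eq (S.upper.take t)
  rw [List.length_take, S.lower_length, min_eq_left htn] at h1
  rw [List.length_take, S.upper_length, min_eq_left htn] at h2
  have h3 := S.lower_le_upper t
  rw [S.height_word]
  have h4 : S.HasSquareAt (S.upper.northCount t - S.lower.northCount t) t := by
    refine ⟨ht, htn, ?_, by omega⟩
    simp only [LatticePath.eastCount, LatticePath.northCount] at h3 ⊢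
    omega
  have := (S.squareWidth_le_iff _).1 le_rfl _ _ h4
  omega

theorem word_mem_concatenations {k : ℕ} (hk : S.squareWidth ≤ k) :
    S.word ∈ PathWord.concatenations (PathWord.arches k) := by
  refine PathWord.descends_of_height (d := 0) (fun t => ?_) (fun t => ?_) ?_
  · have := S.lower_le_upper t
    rw [S.height_word]
    push_cast
    omega
  · exact (S.height_word_le_squareWidth t).trans (by exact_mod_cast hk)
  · rw [S.height_word, S.length_word, LatticePath.northCount, LatticePath.northCount,
      List.take_of_length_le S.upper_length.le, List.take_of_length_le S.lower_length.le,
      S.upper_north, S.lower_north]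
    simp

theorem isMinorUpToIso {m' r' : ℕ} {S : PathPresentation m r} {T : PathPresentation m' r'}
    (h : PathWord.Reduces S.word T.word) : IsMinorUpToIso S.matroid T.matroid :=
  S.presents.isMinorUpToIso T.presents
    (by rwa [S.map_snd_labelledWord, T.map_snd_labelledWord])

end PathPresentation

theorem mainTheorem2 (k : ℕ) :
    IsPreorder (latticePathClass.{u} k) (fun M N => IsMinorUpToIso M.1.2 N.1.2) ∧
      WellQuasiOrdered (fun M N : latticePathClass.{u} k => IsMinorUpToIso M.1.2 N.1.2) := by
  refine ⟨{ refl := fun M => (MatroidIso.refl M.1.2).isMinorUpToIso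
            trans := fun _ _ _ h h' => h.trans h' }, fun f => ?_⟩
  choose m r S hS hiso using fun i => (f i).2
  obtain ⟨i, j, hij, h⟩ := (PathWord.concatenations_partiallyWellOrderedOn
    (fun _ => PathWord.nil_reduces_of_mem_arches)
    (PathWord.arches_partiallyWellOrderedOn k)).exists_lt
    fun i => (S i).word_mem_concatenations (hS i)
  exact ⟨i, j, hij, ((hiso i).isMinorUpToIso.trans
    (PathPresentation.isMinorUpToIso h)).trans (hiso j).symm.isMinorUpToIso⟩
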